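/- All Hilbert spaces are finite-dimensional, complex and non-zero, $L(\mathcal H)$ denotes the linear operators on $\mathcal H$, and a channel is a completely positive trace-preserving linear map between spaces $L(\mathcal H)\to L(\mathcal K)$. The entropy of a density operator is $S(\rho)=-\operatorname{tr}\rho\log\rho$ (logarithm to base $2$), and $S_{\min}(\Phi)=\min_\rho S(\Phi(\rho))$, the minimum being over all density operators $\rho$ on the input space. Let $\Phi:L(\mathcal H)\to L(\mathcal K)$ be a channel. A Stinespring dilation of $\Phi$ with a $d$-dimensional ancilla consists of a space $\mathcal A=\mathbb C^d$ with the basis state $|0\rangle$, a space $\mathcal B$ and a unitary $U:\mathcal A\otimes\mathcal H\to\mathcal K\otimes\mathcal B$ such that $\Phi(X)=\operatorname{tr}_{\mathcal B}U(|0\rangle\langle 0|\otimes X)U^*$ for all $X\in L(\mathcal H)$. The random unitary extension of $\Phi$ built from it is the channel $\Phi'_d:L(\mathcal A\otimes\mathcal H)\to L(\mathcal K\otimes\mathcal B)$, $$\Phi'_d(\rho)=N_{\mathcal B}\bigl(U\,[(M\circ D)(\rho)]\,U^*\bigr).$$ Here, with $P=|0\rangle\langle0|\otimes I_{\mathcal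 H}$ the projector onto $S_0=|0\rangle\otimes\mathcal H$ and $Q=I-P$, the operation $D$ is the decoherence $D(\rho)=\tfrac12\rho+\tfrac12(P-Q)\rho(P-Q)$. The operation $M$ leaves operators on $S_0$ unchanged and completely mixes operators on $S_0^\perp$, so that $$(M\circ D)(\rho)=P\rho P+\operatorname{tr}(Q\rho Q)\,\frac{I_{\mathcal A}-|0\rangle\langle0|}{d-1}\otimes\frac{I_{\mathcal H}}{\dim\mathcal H}$$ (the last summand being $0$ if $d=1$). Finally, $N_{\mathcal B}(Y)=(\operatorname{tr}_{\mathcal B}Y)\otimes I_{\mathcal B}/\dim\mathcal B$. **Theorem.** Let $\Phi:L(\mathcal H)\to L(\mathcal K)$ and $\Psi:L(\mathcal H')\to L(\mathcal K')$ be channels. For every $d$ for which $\Phi$ has a Stinespring dilation with a $d$-dimensional ancilla, choose one such dilation, and let $\Phi'_d$ be the random unitary extension of $\Phi$ built from it. If $$S_{\min}(\Phi'_d\otimes\Psi)=S_{\min}(\Phi'_d)+S_{\min}(\Psi)$$ for all sufficiently large such $d$, then $$S_{\min}(\Phi\otimes\Psi)=S_{\min}(\Phi)+S_{\min}(\Psi).$$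 -/

import Mathlib

open Matrix
open scoped Kronecker ComplexOrder MatrixOrder Matrix.Norms.L2Operator

namespace QInfo

noncomputable section

/-! A finite-dimensional Hilbert space with a chosen orthonormal basis indexed by a finite type `h`
is `ℂ^h`, its space of linear operators is `Matrix h h ℂ`, and tensor products of spaces correspond
to products of index types. -/

/-- A density operator: a positive semidefinite operator of unit trace. -/
def IsDensity {h : Type*} [Fintype h] (ρ : Matrix h h ℂ) : Prop :=
  ρ.PosSemidef ∧ ρ.trace = 1

/-- A quantum channel from operators on `ℂ^h` to operators on `ℂ^k`: a completely positive,
trace preserving linear map. -/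
structure Channel (h k : Type*) [Fintype h] [DecidableEq h] [Fintype k] [DecidableEq k]
    extends CompletelyPositiveMap (Matrix h h ℂ) (Matrix k k ℂ) where
  trace_preserving : ∀ X : Matrix h h ℂ, (toLinearMap X).trace = X.trace

/-- The von Neumann entropy `S(ρ) = - tr (ρ log ρ)`, with logarithm to base two
(and `0 log 0 = 0`). -/
def entropy {h : Type*} [Fintype h] [DecidableEq h] (ρ : Matrix h h ℂ) : ℝ :=
  -(ρ * cfc (Real.logb 2) ρ).trace.re

/-- The minimum output entropy of a linear map `Φ` between operator spaces: the minimum of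
`S(Φ(ρ))` over all density operators `ρ` (for channels on a nonzero space the infimum is
attained, by compactness). -/
def minOutputEntropy {h k : Type*} [Fintype h] [Fintype k] [DecidableEq k]
    (Φ : Matrix h h ℂ →ₗ[ℂ] Matrix k k ℂ) : ℝ :=
  sInf {s : ℝ | ∃ ρ : Matrix h h ℂ, IsDensity ρ ∧ s = entropy (Φ ρ)}

/-- The tensor product `Φ ⊗ Ψ`, the linear map with `(Φ ⊗ Ψ)(X ⊗ Y) = Φ(X) ⊗ Ψ(Y)`. -/
def tensorMap {h k h' k' : Type*} [Fintype h] [DecidableEq h] [Fintype k] [DecidableEq k]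
    [Fintype h'] [DecidableEq h'] [Fintype k'] [DecidableEq k']
    (Φ : Matrix h h ℂ →ₗ[ℂ] Matrix k k ℂ) (Ψ : Matrix h' h' ℂ →ₗ[ℂ] Matrix k' k' ℂ) :
    Matrix (h × h') (h × h') ℂ →ₗ[ℂ] Matrix (k × k') (k × k') ℂ :=
  (kroneckerLinearEquiv k k k' k' ℂ).toLinearMap ∘ₗ TensorProduct.map Φ Ψ ∘ₗ
    (kroneckerLinearEquiv h h h' h' ℂ).symm.toLinearMap

/-- The partial trace over the second tensor factor. -/
def partialTrace {k b : Type*} [Fintype b] :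
    Matrix (k × b) (k × b) ℂ →ₗ[ℂ] Matrix k k ℂ where
  toFun Y := Matrix.of fun i j => ∑ x : b, Y (i, x) (j, x)
  map_add' Y Z := by ext i j; simp [Finset.sum_add_distrib]
  map_smul' c Y := by ext i j; simp [Finset.mul_sum]

/-- The map `X ↦ V X V*`. -/
def conjMap {m n : Type*} [Fintype n] (V : Matrix m n ℂ) :
    Matrix n n ℂ →ₗ[ℂ] Matrix m m ℂ where
  toFun X := V * X * Vᴴ
  map_add' X Y := by simp [Matrix.mul_add, Matrix.add_mul]
  map_smul' c X := by simp

/-- The maximally mixed state `I / dim`. -/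
def maxMixed (b : Type*) [Fintype b] [DecidableEq b] : Matrix b b ℂ :=
  ((Fintype.card b : ℂ)⁻¹) • (1 : Matrix b b ℂ)

/-- The state `|0⟩⟨0|` of a `d`-dimensional ancilla. -/
def ketZero (d : ℕ) [NeZero d] : Matrix (Fin d) (Fin d) ℂ := Matrix.single 0 0 1

/-- A Stinespring dilation of `Φ` with `d`-dimensional ancilla `A = ℂ^d`: a unitary operator
`U : A ⊗ H → K ⊗ B`, where `B = ℂ^b`, with `Φ(X) = tr_B U (|0⟩⟨0| ⊗ X) U*`. -/
structure StinespringDilation {h k : Type*} [Fintype h] [DecidableEq h] [Fintype k]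
    [DecidableEq k] (Φ : Channel h k) (d : ℕ) [NeZero d] where
  b : ℕ
  U : Matrix (k × Fin b) (Fin d × h) ℂ
  conjTranspose_mul_self : Uᴴ * U = 1
  mul_conjTranspose_self : U * Uᴴ = 1
  eq_partialTrace : ∀ X : Matrix h h ℂ,
    Φ.toLinearMap X = partialTrace (U * (ketZero d ⊗ₖ X) * Uᴴ)

/-- The projector `|0⟩⟨0| ⊗ I` onto `S₀ = |0⟩ ⊗ H`. -/
def projZero (d : ℕ) [NeZero d] (h : Type*) [DecidableEq h] :
    Matrix (Fin d × h) (Fin d × h) ℂ := ketZero d ⊗ₖ (1 : Matrix h h ℂ)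

/-- The projector `(I - |0⟩⟨0|) ⊗ I` onto the orthogonal complement of `S₀`. -/
def projPerp (d : ℕ) [NeZero d] (h : Type*) [DecidableEq h] :
    Matrix (Fin d × h) (Fin d × h) ℂ := (1 - ketZero d) ⊗ₖ (1 : Matrix h h ℂ)

/-- The decoherence operation `D`: with probability one half nothing is done, and with probability
one half the unitary is applied that is `1` on `S₀` and `-1` on its orthogonal complement. -/
def decohere (d : ℕ) [NeZero d] (h : Type*) [Fintype h] [DecidableEq h] :
    Matrix (Fin d × h) (Fin d × h) ℂ →ₗ[ℂ] Matrix (Fin d × h) (Fin d × h) ℂ :=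
  (2⁻¹ : ℂ) • LinearMap.id + (2⁻¹ : ℂ) • conjMap (projZero d h - projPerp d h)

/-- The mixing operation `M`: it leaves operators on `S₀` unchanged and completely mixes operators
on its orthogonal complement, that is, it sends such an `X` to
`tr X • ((I - |0⟩⟨0|) / (d - 1)) ⊗ (I / dim H)`. It is only ever applied after the decoherence
operation, so that its input has no block between `S₀` and the complement. (For `d = 1` the
complement is zero, and so is the second summand.) -/
def mixPerp (d : ℕ) [NeZero d] (h : Type*) [Fintype h] [DecidableEq h] :
    Matrix (Fin d × h) (Fin d × h) ℂ →ₗ[ℂ] Matrix (Fin d × h) (Fin d × h) ℂ :=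
  conjMap (projZero d h) +
    (Matrix.traceLinearMap (Fin d × h) ℂ ℂ ∘ₗ conjMap (projPerp d h)).smulRight
      (((((d : ℂ) - 1)⁻¹) • (1 - ketZero d)) ⊗ₖ maxMixed h)

/-- The operation `N_B`, which replaces the state of the second tensor factor by the maximally
mixed state: `N_B(Y) = (tr_B Y) ⊗ (I_B / dim B)`. -/
def depolarize (k b : Type*) [Fintype b] [DecidableEq b] :
    Matrix (k × b) (k × b) ℂ →ₗ[ℂ] Matrix (k × b) (k × b) ℂ where
  toFun Y := partialTrace Y ⊗ₖ maxMixed b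
  map_add' Y Z := by simp [Matrix.add_kronecker]
  map_smul' c Y := by simp [Matrix.smul_kronecker]

/-- The random unitary extension `Φ'(ρ) = N_B (U [(M ∘ D)(ρ)] U*)` of a channel `Φ`, built from a
Stinespring dilation of `Φ`; it maps operators on `A ⊗ H` to operators on `K ⊗ B`. -/
def randomUnitaryExtension {h k : Type*} [Fintype h] [DecidableEq h] [Fintype k]
    [DecidableEq k] {Φ : Channel h k} {d : ℕ} [NeZero d] (V : StinespringDilation Φ d) :
    Matrix (Fin d × h) (Fin d × h) ℂ →ₗ[ℂ] Matrix (k × Fin V.b) (k × Fin V.b) ℂ :=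
  depolarize k (Fin V.b) ∘ₗ conjMap V.U ∘ₗ mixPerp d h ∘ₗ decohere d h

end

end QInfo

/-! The output of the extension is explicit. If `X` is the `|0⟩⟨0|` block of a state `ρ` and `p = tr
X`, then `Φ'_d(ρ) = (Φ(X) + (1 - p) ω) ⊗ I_B / b` with `ω = (b I - Φ(I)) / ((d - 1) dim H)`
(`randomUnitaryExtension_apply`). Unitarity forces `b = d dim H / dim K`, so `ω` differs from `I /
dim K` by a fixed matrix divided by `d - 1` (`perpOutput_sub_maxMixed`).

Mixing a state with the maximally mixed one does not lower its entropy, so for large `d` continuity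
gives `S_min(Φ'_d) ≥ S_min(Φ) + log b - ε`. The continuity estimate is made on `K`, before tensoring
with `I_B / b`; hence its `δ` does not depend on `d`, although `b` grows. In the other direction,
the input `|0⟩⟨0| ⊗ A` shows `S_min(Φ'_d ⊗ Ψ) ≤ S((Φ ⊗ Ψ)(A)) + log b` for every state `A`.

Under additivity for `Φ'_d` the two terms `log b` cancel, and `ε → 0` gives superadditivity for `Φ ⊗
Ψ`. Product inputs give the opposite inequality. -/

namespace QInfo

noncomputable section

/-! ### Entropy as a function of the spectrum -/

/-- The function `x ↦ -x log₂ x`. -/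
def binEta (x : ℝ) : ℝ := Real.negMulLog x / Real.log 2

lemma binEta_eq (x : ℝ) : binEta x = -(x * Real.logb 2 x) := by
  simp [binEta, Real.negMulLog, Real.logb]; ring

lemma concaveOn_binEta : ConcaveOn ℝ (Set.Ici 0) binEta := by
  have := Real.concaveOn_negMulLog.smul (c := (Real.log 2)⁻¹) (by positivity)
  refine this.congr fun x _ => ?_
  simp [binEta, div_eq_inv_mul]

lemma continuous_binEta : Continuous binEta :=
  Real.continuous_negMulLog.div_const _

lemma binEta_mul (x y : ℝ) : binEta (x * y) = y * binEta x + x * binEta y := by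
  simp only [binEta, Real.negMulLog_mul]; ring

lemma entropy_eq_trace_cfc {h : Type*} [Fintype h] [DecidableEq h] {A : Matrix h h ℂ}
    (hA : A.IsHermitian) : entropy A = (cfc binEta A).trace.re := by
  have hc : ∀ f : ℝ → ℝ, ContinuousOn f (spectrum ℝ A) := fun f => by
    rw [continuousOn_iff_continuous_domRestrict]; fun_prop
  have h1 : cfc (fun x => x * Real.logb 2 x) A = A * cfc (Real.logb 2) A := by
    exact (cfc_mul (fun x => x) (Real.logb 2) A (hc _) (hc _)).trans
      (congrArg (· * cfc (Real.logb 2) A) (cfc_id' ℝ A hA))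
  have h2 : binEta = fun x => -(x * Real.logb 2 x) := funext binEta_eq
  rw [h2, cfc_neg, h1, entropy, Matrix.trace_neg, Complex.neg_re]

lemma entropy_eq_sum_eigenvalues {h : Type*} [Fintype h] [DecidableEq h] {A : Matrix h h ℂ}
    (hA : A.IsHermitian) : entropy A = ∑ i, binEta (hA.eigenvalues i) := by
  rw [entropy_eq_trace_cfc hA, hA.cfc_eq, Matrix.IsHermitian.cfc, Unitary.conjStarAlgAut_apply,
    Matrix.trace_mul_comm, ← mul_assoc]
  simp [Matrix.trace]

lemma entropy_eq_sum_roots {h : Type*} [Fintype h] [DecidableEq h] {A : Matrix h h ℂ}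
    (hA : A.IsHermitian) : entropy A = (A.charpoly.roots.map fun z => binEta z.re).sum := by
  rw [entropy_eq_sum_eigenvalues hA, hA.roots_charpoly_eq_eigenvalues, Multiset.map_map]
  simp

/-- Entropy depends only on the characteristic polynomial, so any list of its roots may replace
Mathlib's ordered eigenvalues. -/
lemma entropy_of_charpoly {h n : Type*} [Fintype h] [DecidableEq h] [Fintype n] {A : Matrix h h ℂ}
    (hA : A.IsHermitian) (d : n → ℝ)
    (hd : A.charpoly = ∏ i, (Polynomial.X - Polynomial.C (d i : ℂ))) :
    entropy A = ∑ i, binEta (d i) := by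
  have : A.charpoly.roots = Finset.univ.val.map fun i => (d i : ℂ) := by
    rw [hd, ← Polynomial.roots_multiset_prod_X_sub_C (Finset.univ.val.map fun i => (d i : ℂ)),
      Multiset.map_map]
    rfl
  rw [entropy_eq_sum_roots hA, this, Multiset.map_map]
  simp

lemma entropy_conj_diagonal {h : Type*} [Fintype h] [DecidableEq h] {A V : Matrix h h ℂ}
    (d : h → ℝ) (hV : Vᴴ * V = 1) (hA : A = V * diagonal (fun i => (d i : ℂ)) * Vᴴ) :
    entropy A = ∑ i, binEta (d i) := by
  refine entropy_of_charpoly ?_ d ?_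
  · rw [hA]
    exact isHermitian_mul_mul_conjTranspose _
      (Matrix.isHermitian_diagonal_iff.2 fun i => Complex.conj_ofReal _)
  · rw [hA, charpoly_mul_comm, ← mul_assoc, hV, one_mul, charpoly_diagonal]

lemma exists_conj_diagonal {h : Type*} [Fintype h] [DecidableEq h] {A : Matrix h h ℂ}
    (hA : A.IsHermitian) : ∃ V : Matrix h h ℂ, Vᴴ * V = 1 ∧ V * Vᴴ = 1 ∧
      A = V * diagonal (fun i => (hA.eigenvalues i : ℂ)) * Vᴴ := by
  refine ⟨hA.eigenvectorUnitary, Unitary.coe_star_mul_self _, Unitary.coe_mul_star_self _, ?_⟩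
  conv_lhs => rw [hA.spectral_theorem, Unitary.conjStarAlgAut_apply]
  rfl

lemma entropy_reindex {h n : Type*} [Fintype h] [DecidableEq h] [Fintype n] [DecidableEq n]
    (e : h ≃ n) {A : Matrix h h ℂ} (hA : A.IsHermitian) :
    entropy (reindex e e A) = entropy A := by
  rw [entropy_eq_sum_roots hA, entropy_eq_sum_roots (A := reindex e e A) (hA.submatrix _),
    charpoly_reindex]

lemma sum_eigenvalues_eq_one {h : Type*} [Fintype h] [DecidableEq h] {A : Matrix h h ℂ}
    (hA : A.IsHermitian) (h1 : A.trace = 1) : ∑ i, hA.eigenvalues i = 1 := by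
  have := hA.trace_eq_sum_eigenvalues
  rw [h1] at this
  have h2 := congrArg Complex.re this
  simpa using h2.symm

lemma entropy_kronecker {h n : Type*} [Fintype h] [DecidableEq h] [Fintype n] [DecidableEq n]
    {A : Matrix h h ℂ} {B : Matrix n n ℂ} (hA : A.IsHermitian) (hB : B.IsHermitian)
    (hA1 : A.trace = 1) (hB1 : B.trace = 1) : entropy (A ⊗ₖ B) = entropy A + entropy B := by
  obtain ⟨V, hV, -, hAV⟩ := exists_conj_diagonal hA
  obtain ⟨W, hW, -, hBW⟩ := exists_conj_diagonal hB
  have key : A ⊗ₖ B = (V ⊗ₖ W) *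
      diagonal (fun i : h × n => ((hA.eigenvalues i.1 * hB.eigenvalues i.2 : ℝ) : ℂ)) *
        (V ⊗ₖ W)ᴴ := by
    conv_lhs => rw [hAV, hBW]
    rw [mul_kronecker_mul, mul_kronecker_mul, diagonal_kronecker_diagonal, conjTranspose_kronecker]
    simp
  rw [entropy_conj_diagonal _ ?_ key, entropy_eq_sum_eigenvalues hA, entropy_eq_sum_eigenvalues hB,
    Fintype.sum_prod_type]
  · simp only [binEta_mul, Finset.sum_add_distrib, ← Finset.mul_sum, ← Finset.sum_mul,
      sum_eigenvalues_eq_one hA hA1, sum_eigenvalues_eq_one hB hB1, one_mul]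
  · rw [conjTranspose_kronecker, ← mul_kronecker_mul, hV, hW, one_kronecker_one]

lemma isDensity_maxMixed (b : Type*) [Fintype b] [DecidableEq b] [Nonempty b] :
    IsDensity (maxMixed b) := by
  refine ⟨PosSemidef.one.smul (by positivity), ?_⟩
  simp [maxMixed, Matrix.trace_smul]

lemma entropy_maxMixed (b : Type*) [Fintype b] [DecidableEq b] [Nonempty b] :
    entropy (maxMixed b) = Real.logb 2 (Fintype.card b) := by
  have : maxMixed b = (1 : Matrix b b ℂ) *
      diagonal (fun _ => (((Fintype.card b : ℝ)⁻¹ : ℝ) : ℂ)) * 1ᴴ := by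
    rw [maxMixed, smul_one_eq_diagonal]; simp
  rw [entropy_conj_diagonal _ (by simp) this]
  simp only [binEta_eq, Finset.sum_const, Finset.card_univ, nsmul_eq_mul, Real.logb_inv]
  field_simp

lemma entropy_le_logb_card {h : Type*} [Fintype h] [DecidableEq h] [Nonempty h] {A : Matrix h h ℂ}
    (hA : IsDensity A) : entropy A ≤ Real.logb 2 (Fintype.card h) := by
  have hs := sum_eigenvalues_eq_one hA.1.1 hA.2
  have hk : (0 : ℝ) < Fintype.card h := by positivity
  have := concaveOn_binEta.le_map_sum (t := Finset.univ) (w := fun _ : h => (Fintype.card h : ℝ)⁻¹)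
    (p := hA.1.1.eigenvalues) (fun _ _ => by positivity) (by simp)
    (fun i _ => hA.1.eigenvalues_nonneg i)
  simp only [smul_eq_mul, ← Finset.mul_sum, hs, mul_one, ← entropy_eq_sum_eigenvalues] at this
  rw [binEta_eq, Real.logb_inv, mul_neg, neg_neg] at this
  exact le_of_mul_le_mul_left this (by positivity)

/-- The maximally mixed state is diagonal in an eigenbasis of `A`, so concavity of `binEta` on the
eigenvalues bounds the right side below by `t S(A) + (1 - t) log dim`, and `S(A) ≤ log dim`. -/
lemma entropy_le_entropy_mix_maxMixed {h : Type*} [Fintype h] [DecidableEq h] [Nonempty h]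
    {A : Matrix h h ℂ} (hA : IsDensity A) {t : ℝ} (h0 : 0 ≤ t) (h1 : t ≤ 1) :
    entropy A ≤ entropy ((t : ℂ) • A + ((1 - t : ℝ) : ℂ) • maxMixed h) := by
  obtain ⟨V, hV, hV', hAV⟩ := exists_conj_diagonal hA.1.1
  set l := hA.1.1.eigenvalues with hl
  have key : (t : ℂ) • A + ((1 - t : ℝ) : ℂ) • maxMixed h =
      V * diagonal (fun i => ((t * l i + (1 - t) * (Fintype.card h : ℝ)⁻¹ : ℝ) : ℂ)) * Vᴴ := by
    have h2 : maxMixed h = V * diagonal (fun _ => (Fintype.card h : ℂ)⁻¹) * Vᴴ := by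
      rw [maxMixed, ← smul_one_eq_diagonal]
      simp [hV']
    conv_lhs => rw [h2, hAV]
    rw [← Matrix.smul_mul (t : ℂ), ← Matrix.smul_mul ((1 - t : ℝ) : ℂ), ← Matrix.add_mul]
    congr 1
    ext i j
    simp
    ring
  rw [entropy_conj_diagonal _ hV key]
  have hle := entropy_le_logb_card hA
  have hk : (0 : ℝ) < Fintype.card h := by positivity
  have hterm : ∀ i, t * binEta (l i) + (1 - t) * binEta (Fintype.card h : ℝ)⁻¹ ≤
      binEta (t * l i + (1 - t) * (Fintype.card h : ℝ)⁻¹) := fun i =>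
    concaveOn_binEta.2 (hA.1.eigenvalues_nonneg i) (by simp) h0 (by linarith) (by ring)
  have hsum := Finset.sum_le_sum fun i (_ : i ∈ Finset.univ) => hterm i
  rw [Finset.sum_add_distrib, ← Finset.mul_sum, ← entropy_eq_sum_eigenvalues] at hsum
  have hm : ∑ _i : h, (1 - t) * binEta (Fintype.card h : ℝ)⁻¹ =
      (1 - t) * Real.logb 2 (Fintype.card h) := by
    simp only [binEta_eq, Finset.sum_const, Finset.card_univ, nsmul_eq_mul, Real.logb_inv]
    field_simp
  rw [hm] at hsum
  nlinarith

/-- `binEta` is continuous on all of `ℝ`, so positivity plays no role; this later permits perturbed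
outputs known only to be Hermitian. -/
lemma continuousOn_entropy {h : Type*} [Fintype h] [DecidableEq h] :
    ContinuousOn (entropy (h := h)) {A | A.IsHermitian} := by
  have hc : ContinuousOn (fun A : Matrix h h ℂ => cfc binEta A) {A | IsSelfAdjoint A} :=
    ContinuousOn.cfc_of_mem_nhdsSet (s := Set.univ) binEta Filter.univ_mem continuousOn_id
      (fun x hx => hx) continuous_binEta.continuousOn
  refine ContinuousOn.congr (f := fun A => (cfc binEta A).trace.re) ?_
    fun A hA => entropy_eq_trace_cfc hA
  exact (Complex.continuous_re.comp (continuous_id.matrix_trace)).comp_continuousOn hc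

/-! ### Kraus form of a channel -/

lemma exists_eq_star_mul_self {A : Type*} [NonUnitalCStarAlgebra A] [PartialOrder A]
    [StarOrderedRing A] {a : A} (ha : 0 ≤ a) : ∃ y, a = star y * y :=
  CStarAlgebra.nonneg_iff_eq_star_mul_self.1 ha

lemma Channel.exists_kraus {h k : Type*} [Fintype h] [DecidableEq h] [Fintype k] [DecidableEq k]
    (Φ : Channel h k) : ∃ K : h × k → Matrix k h ℂ,
      ∀ X, Φ.toLinearMap X = ∑ x, K x * X * (K x)ᴴ := by
  rcases isEmpty_or_nonempty h with hh | ⟨⟨i₀⟩⟩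
  · exact ⟨0, fun X => by simp [Subsingleton.elim X 0]⟩
  -- `w` is supported on column `i₀`, and `w * star w` is the block matrix of all matrix units. Its
  -- image under `Φ`, the Choi matrix, is therefore positive; the rows of a factor `y` of it give
  -- the Kraus operators.
  let w : CStarMatrix h h (Matrix h h ℂ) :=
    CStarMatrix.ofMatrix fun i j => if j = i₀ then Matrix.single i i₀ 1 else 0
  have hw : ∀ i j, (w * star w) i j = Matrix.single i j 1 := by
    intro i j
    rw [CStarMatrix.mul_apply, Finset.sum_eq_single i₀]
    · rw [CStarMatrix.star_apply]
      change (if i₀ = i₀ then Matrix.single i i₀ (1 : ℂ) else 0) *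
        (if i₀ = i₀ then Matrix.single j i₀ (1 : ℂ) else 0)ᴴ = _
      simp
    · intro b _ hb
      have : w i b = 0 := if_neg hb
      rw [this, zero_mul]
    · simp
  have h0 := Φ.toCompletelyPositiveMap.map_cstarMatrix_nonneg (w * star w) (mul_star_self_nonneg w)
  obtain ⟨y, hy⟩ := exists_eq_star_mul_self h0
  have hE : ∀ i j, Φ.toLinearMap (Matrix.single i j 1) = ∑ l, (y l i)ᴴ * y l j := by
    intro i j
    have := congrArg (fun M : CStarMatrix h h (Matrix k k ℂ) => M i j) hy
    simp only [CStarMatrix.map_apply, hw] at this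
    rw [CStarMatrix.mul_apply] at this
    exact this
  refine ⟨fun x => Matrix.of fun a i => star (y x.1 i x.2 a), fun X => ?_⟩
  conv_lhs => rw [Matrix.matrix_eq_sum_single X]
  ext a b
  have hs : ∀ i j, Matrix.single i j (X i j) = X i j • Matrix.single i j (1 : ℂ) := by simp
  simp only [map_sum, hs, map_smul, hE]
  simp only [Matrix.sum_apply, Matrix.smul_apply, Matrix.mul_apply, Matrix.conjTranspose_apply,
    Matrix.of_apply, smul_eq_mul, Fintype.sum_prod_type, star_star, Finset.mul_sum, Finset.sum_mul]
  have hsw : ∀ G : h → h → k → ℂ, ∑ j, ∑ l, ∑ c, G j l c = ∑ l, ∑ c, ∑ j, G j l c := fun G => by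
    rw [Finset.sum_comm]
    exact Finset.sum_congr rfl fun _ _ => Finset.sum_comm
  rw [Finset.sum_congr rfl fun i _ => hsw _, hsw]
  refine Finset.sum_congr rfl fun l _ => Finset.sum_congr rfl fun c _ => ?_
  rw [Finset.sum_comm]
  refine Finset.sum_congr rfl fun j _ => Finset.sum_congr rfl fun i _ => ?_
  ring

lemma Channel.map_conjTranspose {h k : Type*} [Fintype h] [DecidableEq h] [Fintype k]
    [DecidableEq k] (Φ : Channel h k) (X : Matrix h h ℂ) :
    Φ.toLinearMap Xᴴ = (Φ.toLinearMap X)ᴴ := by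
  obtain ⟨K, hK⟩ := Φ.exists_kraus
  simp [hK, conjTranspose_sum, Matrix.mul_assoc]

lemma Channel.posSemidef_map {h k : Type*} [Fintype h] [DecidableEq h] [Fintype k]
    [DecidableEq k] (Φ : Channel h k) {X : Matrix h h ℂ} (hX : X.PosSemidef) :
    (Φ.toLinearMap X).PosSemidef := by
  obtain ⟨K, hK⟩ := Φ.exists_kraus
  rw [hK]
  exact posSemidef_sum _ fun x _ => hX.mul_mul_conjTranspose_same _

lemma Channel.isDensity_map {h k : Type*} [Fintype h] [DecidableEq h] [Fintype k]
    [DecidableEq k] (Φ : Channel h k) {X : Matrix h h ℂ} (hX : IsDensity X) :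
    IsDensity (Φ.toLinearMap X) :=
  ⟨Φ.posSemidef_map hX.1, (Φ.trace_preserving X).trans hX.2⟩

/-! ### Compactness of the state space and minimum output entropy -/

lemma IsDensity.norm_le_one {h : Type*} [Fintype h] [DecidableEq h] {A : Matrix h h ℂ}
    (hA : IsDensity A) : ‖A‖ ≤ 1 := by
  obtain ⟨V, hV, hV', hAV⟩ := exists_conj_diagonal hA.1.1
  have hU : V ∈ unitary (Matrix h h ℂ) := ⟨hV, hV'⟩
  rw [hAV, ← star_eq_conjTranspose, CStarRing.norm_mul_mem_unitary _ (Unitary.star_mem hU),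
    CStarRing.norm_mem_unitary_mul _ hU, l2_opNorm_diagonal, pi_norm_le_iff_of_nonneg zero_le_one]
  intro i
  have h0 := hA.1.eigenvalues_nonneg
  have h1 := Finset.single_le_sum (fun j _ => h0 j) (Finset.mem_univ i)
  rw [sum_eigenvalues_eq_one hA.1.1 hA.2] at h1
  simpa [abs_of_nonneg (h0 i)] using h1

lemma isCompact_setOf_isDensity (h : Type*) [Fintype h] [DecidableEq h] :
    IsCompact {A : Matrix h h ℂ | IsDensity A} := by
  have : ProperSpace (Matrix h h ℂ) := FiniteDimensional.proper ℂ _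
  refine (isCompact_closedBall (0 : Matrix h h ℂ) 1).of_isClosed_subset ?_ fun A hA => by
    simpa using IsDensity.norm_le_one hA
  have : {A : Matrix h h ℂ | IsDensity A} = {A | 0 ≤ A} ∩ {A | A.trace = 1} := by
    ext A; simp [IsDensity, nonneg_iff_posSemidef]
  rw [this]
  exact CStarAlgebra.isClosed_nonneg.inter
    (isClosed_eq continuous_id.matrix_trace continuous_const)

section MinOutputEntropy

variable {h k : Type*} [Fintype h] [DecidableEq h] [Fintype k] [DecidableEq k]
  {f : Matrix h h ℂ →ₗ[ℂ] Matrix k k ℂ}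

/-- The infimum needs a lower bound to be meaningful. Compactness supplies it for any map commuting
with the adjoint, so positivity of `Φ'_d ⊗ Ψ` never has to be shown. -/
lemma minOutputEntropy_le (hf : ∀ X, f Xᴴ = (f X)ᴴ) {A : Matrix h h ℂ} (hA : IsDensity A) :
    minOutputEntropy f ≤ entropy (f A) := by
  refine csInf_le ?_ ⟨A, hA, rfl⟩
  have hc : ContinuousOn (fun A => entropy (f A)) {A : Matrix h h ℂ | IsDensity A} :=
    continuousOn_entropy.comp (LinearMap.continuous_of_finiteDimensional f).continuousOn
      fun A hA => by
        have := hf A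
        rw [hA.1.1.eq] at this
        exact this.symm
  convert ((isCompact_setOf_isDensity h).image_of_continuousOn hc).bddBelow using 1
  ext s
  simp [eq_comm]

lemma le_minOutputEntropy [Nonempty h] {c : ℝ}
    (hc : ∀ A : Matrix h h ℂ, IsDensity A → c ≤ entropy (f A)) : c ≤ minOutputEntropy f := by
  refine le_csInf ⟨_, maxMixed h, isDensity_maxMixed h, rfl⟩ ?_
  rintro _ ⟨A, hA, rfl⟩
  exact hc A hA

end MinOutputEntropy

/-! ### Tensor products of maps; subadditivity -/

section TensorMap

variable {h k h' k' : Type*} [Fintype h] [DecidableEq h] [Fintype k] [DecidableEq k]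
    [Fintype h'] [DecidableEq h'] [Fintype k'] [DecidableEq k']

lemma kronecker_induction {h h' : Type*} [Fintype h] [DecidableEq h] [Fintype h'] [DecidableEq h']
    {p : Matrix (h × h') (h × h') ℂ → Prop}
    (hadd : ∀ X Y, p X → p Y → p (X + Y)) (hk : ∀ X Y, p (X ⊗ₖ Y)) (Z) : p Z := by
  obtain ⟨z, rfl⟩ := (kroneckerLinearEquiv h h h' h' ℂ).surjective Z
  induction z using TensorProduct.induction_on with
  | zero => simpa using hk 0 0
  | tmul X Y => exact hk X Y
  | add x y hx hy => rw [map_add]; exact hadd _ _ hx hy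

lemma tensorMap_kronecker (Φ : Matrix h h ℂ →ₗ[ℂ] Matrix k k ℂ)
    (Ψ : Matrix h' h' ℂ →ₗ[ℂ] Matrix k' k' ℂ) (X : Matrix h h ℂ) (Y : Matrix h' h' ℂ) :
    tensorMap Φ Ψ (X ⊗ₖ Y) = Φ X ⊗ₖ Ψ Y := by
  simp [tensorMap]

lemma tensorMap_conjTranspose {Φ : Matrix h h ℂ →ₗ[ℂ] Matrix k k ℂ}
    {Ψ : Matrix h' h' ℂ →ₗ[ℂ] Matrix k' k' ℂ} (hΦ : ∀ X, Φ Xᴴ = (Φ X)ᴴ)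
    (hΨ : ∀ X, Ψ Xᴴ = (Ψ X)ᴴ) (Z : Matrix (h × h') (h × h') ℂ) :
    tensorMap Φ Ψ Zᴴ = (tensorMap Φ Ψ Z)ᴴ := by
  induction Z using kronecker_induction with
  | hadd X Y hX hY => simp [hX, hY]
  | hk X Y => simp only [conjTranspose_kronecker, tensorMap_kronecker, hΦ, hΨ]

lemma trace_tensorMap {Φ : Matrix h h ℂ →ₗ[ℂ] Matrix k k ℂ}
    {Ψ : Matrix h' h' ℂ →ₗ[ℂ] Matrix k' k' ℂ} (hΦ : ∀ X, (Φ X).trace = X.trace)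
    (hΨ : ∀ X, (Ψ X).trace = X.trace) (Z : Matrix (h × h') (h × h') ℂ) :
    (tensorMap Φ Ψ Z).trace = Z.trace := by
  induction Z using kronecker_induction with
  | hadd X Y hX hY => simp [hX, hY]
  | hk X Y => simp only [trace_kronecker, tensorMap_kronecker, hΦ, hΨ]

lemma IsDensity.kronecker {h h' : Type*} [Fintype h] [Fintype h'] {X : Matrix h h ℂ} {Y : Matrix h' h' ℂ} (hX : IsDensity X)
    (hY : IsDensity Y) : IsDensity (X ⊗ₖ Y) :=
  ⟨hX.1.kronecker hY.1, by rw [trace_kronecker, hX.2, hY.2, one_mul]⟩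

lemma minOutputEntropy_tensorMap_le [Nonempty h] [Nonempty h'] (Φ : Channel h k)
    (Ψ : Channel h' k') : minOutputEntropy (tensorMap Φ.toLinearMap Ψ.toLinearMap) ≤
      minOutputEntropy Φ.toLinearMap + minOutputEntropy Ψ.toLinearMap := by
  rw [← sub_le_iff_le_add]
  refine le_minOutputEntropy fun A hA => ?_
  rw [sub_le_comm]
  refine le_minOutputEntropy fun B hB => ?_
  rw [sub_le_iff_le_add']
  have := minOutputEntropy_le (tensorMap_conjTranspose Φ.map_conjTranspose Ψ.map_conjTranspose)
    (hA.kronecker hB)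
  have hA' := Φ.isDensity_map hA
  have hB' := Ψ.isDensity_map hB
  rwa [tensorMap_kronecker, entropy_kronecker hA'.1.1 hB'.1.1 hA'.2 hB'.2] at this

end TensorMap

/-! ### Existence of Stinespring dilations -/

lemma mul_ketZero_kronecker_mul {h n : Type*} [Fintype h] {d : ℕ} [NeZero d]
    (U : Matrix n (Fin d × h) ℂ) (X : Matrix h h ℂ) :
    U * (ketZero d ⊗ₖ X) * Uᴴ =
      U.submatrix id (Prod.mk 0) * X * (U.submatrix id (Prod.mk 0))ᴴ := by
  have h1 : U * (ketZero d ⊗ₖ X) =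
      Matrix.of fun p q => if q.1 = 0 then (U.submatrix id (Prod.mk 0) * X) p q.2 else 0 := by
    ext p ⟨a, i⟩
    rw [Matrix.mul_apply, Fintype.sum_prod_type, Finset.sum_eq_single 0]
    · by_cases ha : a = 0
      · subst ha; simp [ketZero, Matrix.mul_apply]
      · simp [ketZero, ha, Ne.symm ha]
    · intro c _ hc
      simp [ketZero, Ne.symm hc]
    · simp
  rw [h1]
  ext p q
  rw [Matrix.mul_apply, Fintype.sum_prod_type, Finset.sum_eq_single 0]
  · rw [Matrix.mul_apply]
    simp
  · intro c _ hc
    simp [hc]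
  · simp

lemma Channel.exists_kraus_fin {h k : Type*} [Fintype h] [DecidableEq h] [Fintype k]
    [DecidableEq k] (Φ : Channel h k) {b : ℕ} (hb : Fintype.card h * Fintype.card k ≤ b) :
    ∃ K : Fin b → Matrix k h ℂ, ∀ X, Φ.toLinearMap X = ∑ x, K x * X * (K x)ᴴ := by
  obtain ⟨K, hK⟩ := Φ.exists_kraus
  obtain ⟨e⟩ : Nonempty (h × k ↪ Fin b) :=
    Function.Embedding.nonempty_of_card_le (by simpa using hb)
  refine ⟨Function.extend e K 0, fun X => ?_⟩
  rw [hK, ← Finset.sum_subset (Finset.subset_univ (Finset.univ.map e)), Finset.sum_map]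
  · simp [e.injective.extend_apply]
  · intro x _ hx
    rw [Function.extend_apply' _ _ _ (by simpa using hx)]
    simp

lemma Channel.sum_conjTranspose_mul {h k b : Type*} [Fintype h] [DecidableEq h] [Fintype k]
    [DecidableEq k] [Fintype b] {Φ : Channel h k} {K : b → Matrix k h ℂ}
    (hK : ∀ X, Φ.toLinearMap X = ∑ x, K x * X * (K x)ᴴ) : ∑ x, (K x)ᴴ * K x = 1 := by
  ext i j
  have h1 := Φ.trace_preserving (Matrix.single j i 1)
  have h2 : (Matrix.single j i (1 : ℂ)).trace = (1 : Matrix h h ℂ) i j := by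
    rw [Matrix.one_apply]
    split_ifs with hij
    · subst hij; simp
    · exact Matrix.trace_single_eq_of_ne _ _ _ (Ne.symm hij)
  rw [hK, trace_sum, h2] at h1
  rw [Matrix.sum_apply, ← h1]
  refine Finset.sum_congr rfl fun x _ => ?_
  rw [Matrix.trace_mul_comm, ← Matrix.mul_assoc]
  simp [Matrix.trace_mul_single]

/-- Stacked Kraus operators form an isometry `H → K ⊗ B`; its columns extend to an orthonormal
basis, which is a unitary because the dimensions match. The bound on `b` leaves room for all Kraus
operators, padded by zeros. -/
lemma Channel.nonempty_stinespringDilation {h k : Type*} [Fintype h] [DecidableEq h] [Fintype k]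
    [DecidableEq k] (Φ : Channel h k) {d b : ℕ} [NeZero d]
    (hdb : d * Fintype.card h = Fintype.card k * b)
    (hb : Fintype.card h * Fintype.card k ≤ b) : Nonempty (StinespringDilation Φ d) := by
  obtain ⟨K, hK⟩ := Φ.exists_kraus_fin hb
  have hK1 := Channel.sum_conjTranspose_mul hK
  let v : Fin d × h → EuclideanSpace ℂ (k × Fin b) := fun p => WithLp.toLp 2 fun q => K q.2 q.1 p.2
  have hv : Orthonormal ℂ (({p | p.1 = 0} : Set (Fin d × h)).domRestrict v) := by
    rw [orthonormal_iff_ite]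
    rintro ⟨⟨a', i⟩, ha'⟩ ⟨⟨a, j⟩, ha⟩
    obtain rfl : a = 0 := ha
    obtain rfl : a' = 0 := ha'
    have := congrFun (congrFun hK1 i) j
    simp only [Matrix.sum_apply, Matrix.mul_apply, Matrix.conjTranspose_apply,
      Matrix.one_apply] at this
    simp [v, PiLp.inner_apply, Fintype.sum_prod_type_right, mul_comm, ← this]
  obtain ⟨B, hB⟩ := hv.exists_orthonormalBasis_extension_of_card_eq (by simp [hdb])
  let U : Matrix (k × Fin b) (Fin d × h) ℂ := Matrix.of fun p q => B q p
  have hU : Uᴴ * U = 1 := by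
    ext p q
    have := orthonormal_iff_ite.1 B.orthonormal p q
    rw [Matrix.one_apply, ← this]
    simp [U, Matrix.mul_apply, PiLp.inner_apply, mul_comm]
  have hV : U.submatrix id (Prod.mk 0) = Matrix.of fun p i => K p.2 p.1 i := by
    ext p i
    simp [U, hB (0, i) rfl, v]
  refine ⟨⟨b, U, hU, (Matrix.mul_eq_one_comm_of_card_eq _ _ _ (by simp [hdb])).1 hU, fun X => ?_⟩⟩
  rw [hK, mul_ketZero_kronecker_mul, hV]
  ext a a'
  simp [partialTrace, Matrix.sum_apply, Matrix.mul_apply]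

lemma StinespringDilation.mul_card {h k : Type*} [Fintype h] [DecidableEq h] [Fintype k]
    [DecidableEq k] {Φ : Channel h k} {d : ℕ} [NeZero d] (V : StinespringDilation Φ d) :
    d * Fintype.card h = Fintype.card k * V.b := by
  have := Matrix.trace_mul_comm V.U V.Uᴴ
  rw [V.conjTranspose_mul_self, V.mul_conjTranspose_self] at this
  simp only [trace_one, Fintype.card_prod, Fintype.card_fin] at this
  exact_mod_cast this.symm

/-! ### Explicit form of the random unitary extension -/

section Mixing

variable {d : ℕ} [NeZero d] {h : Type*} [Fintype h] [DecidableEq h]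

lemma ketZero_mul_ketZero : ketZero d * ketZero d = ketZero d := by
  simp [ketZero]

lemma conjTranspose_ketZero : (ketZero d)ᴴ = ketZero d := by
  simp [ketZero]

lemma one_sub_ketZero_kronecker_one {d : ℕ} [NeZero d] {h : Type*} [DecidableEq h] :
    (1 - ketZero d) ⊗ₖ (1 : Matrix h h ℂ) = 1 - ketZero d ⊗ₖ (1 : Matrix h h ℂ) := by
  rw [eq_sub_iff_add_eq, ← add_kronecker, sub_add_cancel, one_kronecker_one]

lemma projZero_conj (ρ : Matrix (Fin d × h) (Fin d × h) ℂ) :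
    projZero d h * ρ * (projZero d h)ᴴ =
      ketZero d ⊗ₖ ρ.submatrix (Prod.mk 0) (Prod.mk 0) := by
  have hp : projZero d h = diagonal fun p => if p.1 = 0 then 1 else 0 := by
    ext ⟨a, i⟩ ⟨b, j⟩
    by_cases ha : a = 0 <;> by_cases hb : b = 0 <;> by_cases hij : i = j <;>
      simp [projZero, ketZero, Matrix.diagonal_apply, ha, hb, hij, eq_comm]
  rw [hp, diagonal_conjTranspose]
  ext ⟨a, i⟩ ⟨b, j⟩
  by_cases ha : a = 0 <;> by_cases hb : b = 0 <;>
    simp [ketZero, ha, hb, eq_comm]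

/-- `D` alters only the blocks between `S₀` and its complement, which `M` does not see, so `D` drops
out. -/
lemma mixPerp_decohere (ρ : Matrix (Fin d × h) (Fin d × h) ℂ) :
    mixPerp d h (decohere d h ρ) = ketZero d ⊗ₖ ρ.submatrix (Prod.mk 0) (Prod.mk 0) +
      (ρ.trace - (ρ.submatrix (Prod.mk 0) (Prod.mk 0)).trace) •
        (((((d : ℂ) - 1)⁻¹) • (1 - ketZero d)) ⊗ₖ maxMixed h) := by
  have hconj := projZero_conj ρ
  set P := projZero d h with hP
  set Q := projPerp d h with hQ
  have hPP : P * P = P := by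
    rw [hP, projZero, ← mul_kronecker_mul, ketZero_mul_ketZero, one_mul]
  have hPs : Pᴴ = P := by
    rw [hP, projZero, conjTranspose_kronecker, conjTranspose_ketZero, conjTranspose_one]
  have hQP : Q = 1 - P := by
    rw [hP, hQ, projZero, projPerp, one_sub_ketZero_kronecker_one]
  have hQs : Qᴴ = Q := by rw [hQP, conjTranspose_sub, hPs, conjTranspose_one]
  have hQQ : Q * Q = Q := by rw [hQP, mul_sub, mul_one, sub_mul, hPP]; simp
  have hPQ : P * Q = 0 := by rw [hQP, mul_sub, hPP]; simp
  have hQP' : Q * P = 0 := by rw [hQP, sub_mul, hPP]; simp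
  have h1 : P * decohere d h ρ * P = P * ρ * P := by
    have : P * ((P - Q) * ρ * (P - Q)) * P = (P * (P - Q)) * ρ * ((P - Q) * P) := by noncomm_ring
    simp only [decohere, conjMap, LinearMap.add_apply, LinearMap.smul_apply, LinearMap.id_apply,
      LinearMap.coe_mk, AddHom.coe_mk, ← hP, ← hQ, conjTranspose_sub, hPs, hQs, mul_add, add_mul,
      Matrix.mul_smul, Matrix.smul_mul, this]
    rw [mul_sub P, sub_mul P, hPP, hPQ, hQP', sub_zero, ← add_smul]
    norm_num
  have h2 : Q * decohere d h ρ * Q = Q * ρ * Q := by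
    have : Q * ((P - Q) * ρ * (P - Q)) * Q = (Q * (P - Q)) * ρ * ((P - Q) * Q) := by noncomm_ring
    simp only [decohere, conjMap, LinearMap.add_apply, LinearMap.smul_apply, LinearMap.id_apply,
      LinearMap.coe_mk, AddHom.coe_mk, ← hP, ← hQ, conjTranspose_sub, hPs, hQs, mul_add, add_mul,
      Matrix.mul_smul, Matrix.smul_mul, this]
    rw [mul_sub Q, sub_mul P, hQQ, hPQ, hQP', zero_sub, neg_mul, neg_mul_neg, ← add_smul]
    norm_num
  have h3 : (Q * ρ * Q).trace = ρ.trace - (ρ.submatrix (Prod.mk 0) (Prod.mk 0)).trace := by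
    have h4 : (P * ρ * P).trace = (ρ.submatrix (Prod.mk 0) (Prod.mk (0 : Fin d))).trace := by
      rw [hPs] at hconj
      rw [hconj, trace_kronecker]
      simp [ketZero]
    rw [Matrix.trace_mul_comm, ← mul_assoc, hPP] at h4
    rw [Matrix.trace_mul_comm, ← mul_assoc, hQQ, hQP, sub_mul, trace_sub, one_mul, h4]
  rw [hPs] at hconj
  simp only [mixPerp, conjMap, LinearMap.add_apply, LinearMap.smulRight_apply, LinearMap.comp_apply,
    LinearMap.coe_mk, AddHom.coe_mk, traceLinearMap_apply, ← hP, ← hQ, hPs, hQs, h1, h2, h3, hconj]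

end Mixing

section RandomUnitaryExtension

variable {h k : Type*} [Fintype h] [DecidableEq h] [Fintype k] [DecidableEq k]
  {Φ : Channel h k} {d : ℕ} [NeZero d]

/-- The output on `K` of the dilation on the maximally mixed state of the complement of `S₀`. -/
def StinespringDilation.perpOutput (V : StinespringDilation Φ d) : Matrix k k ℂ :=
  (((d : ℂ) - 1)⁻¹ * (Fintype.card h : ℂ)⁻¹) • ((V.b : ℂ) • 1 - Φ.toLinearMap 1)

lemma randomUnitaryExtension_apply (V : StinespringDilation Φ d)
    (ρ : Matrix (Fin d × h) (Fin d × h) ℂ) :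
    randomUnitaryExtension V ρ = (Φ.toLinearMap (ρ.submatrix (Prod.mk 0) (Prod.mk 0)) +
      (ρ.trace - (ρ.submatrix (Prod.mk 0) (Prod.mk 0)).trace) • V.perpOutput) ⊗ₖ
        maxMixed (Fin V.b) := by
  have h1 : partialTrace (conjMap V.U (1 : Matrix (Fin d × h) (Fin d × h) ℂ)) =
      (V.b : ℂ) • (1 : Matrix k k ℂ) := by
    have hU : conjMap V.U 1 = 1 := by
      change V.U * (1 : Matrix (Fin d × h) (Fin d × h) ℂ) * V.Uᴴ = 1
      rw [Matrix.mul_one, V.mul_conjTranspose_self]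
    rw [hU]
    ext i j
    by_cases hij : i = j <;> simp [partialTrace, Matrix.one_apply, hij]
  have h2 : ∀ X : Matrix h h ℂ, partialTrace (conjMap V.U (ketZero d ⊗ₖ X)) = Φ.toLinearMap X :=
    fun X => (V.eq_partialTrace X).symm
  have h3 : (((d : ℂ) - 1)⁻¹ • (1 - ketZero d)) ⊗ₖ maxMixed h =
      (((d : ℂ) - 1)⁻¹ * (Fintype.card h : ℂ)⁻¹) •
        ((1 : Matrix (Fin d × h) (Fin d × h) ℂ) - ketZero d ⊗ₖ (1 : Matrix h h ℂ)) := by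
    rw [maxMixed, smul_kronecker, kronecker_smul, smul_smul, one_sub_ketZero_kronecker_one]
  have h4 : partialTrace (conjMap V.U ((((d : ℂ) - 1)⁻¹ • (1 - ketZero d)) ⊗ₖ maxMixed h)) =
      V.perpOutput := by
    rw [h3, map_smul, map_smul, map_sub, map_sub, h1, h2]
    rfl
  change partialTrace (conjMap V.U (mixPerp d h (decohere d h ρ))) ⊗ₖ _ = _
  rw [mixPerp_decohere, map_add, map_add, h2, map_smul, map_smul, h4]

lemma StinespringDilation.b_pos [Nonempty h] (V : StinespringDilation Φ d) : 0 < V.b := by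
  have h0 : 0 < d * Fintype.card h := Nat.mul_pos (NeZero.pos d) Fintype.card_pos
  rw [V.mul_card] at h0
  exact Nat.pos_of_mul_pos_left h0

lemma StinespringDilation.isHermitian_perpOutput (V : StinespringDilation Φ d) :
    V.perpOutput.IsHermitian := by
  have := Φ.map_conjTranspose 1
  rw [conjTranspose_one] at this
  simp [Matrix.IsHermitian, perpOutput, conjTranspose_smul, ← this]

/-- The matrix multiplied by `(d - 1)⁻¹` depends neither on `d` nor on the dilation, so convergence
to the maximally mixed state is uniform over the chosen dilations. -/
lemma StinespringDilation.perpOutput_sub_maxMixed [Nonempty h] [Nonempty k]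
    (V : StinespringDilation Φ d) (hd : 2 ≤ d) :
    V.perpOutput - maxMixed k = ((d : ℂ) - 1)⁻¹ • ((Fintype.card h : ℂ)⁻¹ •
      (((Fintype.card h : ℂ) / Fintype.card k) • (1 : Matrix k k ℂ) - Φ.toLinearMap 1)) := by
  have hb : (V.b : ℂ) = d * Fintype.card h / Fintype.card k := by
    rw [eq_div_iff (by simp), mul_comm]
    exact_mod_cast V.mul_card.symm
  have hd' : (d : ℂ) - 1 ≠ 0 := by
    rw [sub_ne_zero]; exact_mod_cast (by omega : d ≠ 1)
  have hk : (Fintype.card k : ℂ) ≠ 0 := by simp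
  have hh : (Fintype.card h : ℂ) ≠ 0 := by simp
  rw [perpOutput, maxMixed, hb]
  simp only [smul_sub, smul_smul]
  rw [sub_right_comm, ← sub_smul]
  congr 2
  field_simp
  ring

lemma StinespringDilation.trace_perpOutput [Nonempty h] [Nonempty k]
    (V : StinespringDilation Φ d) (hd : 2 ≤ d) : V.perpOutput.trace = 1 := by
  have hk : (Fintype.card k : ℂ) ≠ 0 := by simp
  have := congrArg Matrix.trace (V.perpOutput_sub_maxMixed hd)
  rw [trace_sub, (isDensity_maxMixed k).2, trace_smul, trace_smul, trace_sub, trace_smul,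
    Φ.trace_preserving, trace_one, trace_one, smul_eq_mul (_ / _), div_mul_cancel₀ _ hk,
    sub_self, smul_zero, smul_zero, sub_eq_zero] at this
  exact this

lemma randomUnitaryExtension_conjTranspose (V : StinespringDilation Φ d)
    (ρ : Matrix (Fin d × h) (Fin d × h) ℂ) :
    randomUnitaryExtension V ρᴴ = (randomUnitaryExtension V ρ)ᴴ := by
  have hm : (maxMixed (Fin V.b))ᴴ = maxMixed (Fin V.b) := by simp [maxMixed]
  rw [randomUnitaryExtension_apply, randomUnitaryExtension_apply, conjTranspose_kronecker, hm,
    conjTranspose_add, conjTranspose_smul, V.isHermitian_perpOutput.eq, ← Φ.map_conjTranspose,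
    star_sub, ← trace_conjTranspose, ← trace_conjTranspose]
  rfl

end RandomUnitaryExtension

/-! ### Lower bound for the extension -/

lemma entropy_near_density {h : Type*} [Fintype h] [DecidableEq h] {ε : ℝ} (hε : 0 < ε) :
    ∃ δ > 0, ∀ A B : Matrix h h ℂ, IsDensity A → B.IsHermitian → ‖B - A‖ < δ →
      entropy A - ε < entropy B := by
  -- Passing to the Hermitian part makes entropy continuous on all matrices, so that uniform
  -- continuity at a compact set applies.
  let g : Matrix h h ℂ → ℝ := fun A => entropy ((2⁻¹ : ℂ) • (A + Aᴴ))
  have hherm : ∀ A : Matrix h h ℂ, ((2⁻¹ : ℂ) • (A + Aᴴ)).IsHermitian := fun A => by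
    simp [Matrix.IsHermitian, conjTranspose_smul, add_comm]
  have hc : Continuous fun A : Matrix h h ℂ => (2⁻¹ : ℂ) • (A + Aᴴ) := by
    have h0 : Continuous fun A : Matrix h h ℂ => A + Aᴴ :=
      continuous_id.add continuous_id.matrix_conjTranspose
    exact h0.const_smul (2⁻¹ : ℂ)
  have hcont : Continuous g := continuousOn_entropy.comp_continuous hc hherm
  have hg : ∀ A : Matrix h h ℂ, A.IsHermitian → g A = entropy A := fun A hA => by
    simp only [g, hA.eq, ← two_smul ℂ A, smul_smul]
    norm_num
  have := (isCompact_setOf_isDensity h).uniformContinuousAt_of_continuousAt g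
    (fun _ _ => hcont.continuousAt) (Metric.dist_mem_uniformity hε)
  obtain ⟨δ, hδ, hd⟩ := Metric.mem_uniformity_dist.1 this
  refine ⟨δ, hδ, fun A B hA hB hAB => ?_⟩
  have h1 := hd (a := A) (b := B) (by rwa [dist_comm, dist_eq_norm]) hA
  simp only [Set.mem_ofPred_eq, hg A hA.1.1, hg B hB, Real.dist_eq] at h1
  linarith [(abs_lt.1 h1).2]

lemma exists_density_smul {h : Type*} [Fintype h] [DecidableEq h] [Nonempty h]
    {X : Matrix h h ℂ} (hX : X.PosSemidef) : ∃ A, IsDensity A ∧ X = (X.trace.re : ℂ) • A := by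
  have ht : X.trace = (X.trace.re : ℂ) := by
    have := hX.trace_nonneg
    exact Complex.ext rfl (by simpa using (Complex.le_def.1 this).2.symm)
  by_cases h0 : X = 0
  · exact ⟨maxMixed h, isDensity_maxMixed h, by simp [h0]⟩
  · have hne : X.trace ≠ 0 := fun h => h0 (hX.trace_eq_zero_iff.1 h)
    refine ⟨X.trace⁻¹ • X, ⟨hX.smul (inv_nonneg.2 hX.trace_nonneg), ?_⟩, ?_⟩
    · rw [trace_smul, smul_eq_mul, inv_mul_cancel₀ hne]
    · rw [← ht, smul_smul, mul_inv_cancel₀ hne, one_smul]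

lemma trace_submatrix_mem_Icc {h : Type*} [Fintype h] {d : ℕ} [NeZero d] {A : Matrix (Fin d × h) (Fin d × h) ℂ} (hA : IsDensity A) :
    (A.submatrix (Prod.mk 0) (Prod.mk (0 : Fin d)) : Matrix h h ℂ).trace.re ∈ Set.Icc 0 1 := by
  have hd := fun p => (Complex.le_def.1 (hA.1.diag_nonneg (i := p))).1
  have h1 := congrArg Complex.re hA.2
  simp only [Matrix.trace, Matrix.diag_apply, Complex.re_sum, Complex.one_re, Complex.zero_re,
    Matrix.submatrix_apply] at hd h1 ⊢
  refine ⟨Finset.sum_nonneg fun i _ => hd _, ?_⟩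
  rw [← h1, Fintype.sum_prod_type]
  exact Finset.single_le_sum (f := fun a : Fin d => ∑ i : h, (A (a, i) (a, i)).re)
    (fun a _ => Finset.sum_nonneg fun i _ => hd _) (Finset.mem_univ 0)

section

variable {h k : Type*} [Fintype h] [DecidableEq h] [Fintype k] [DecidableEq k]
  {Φ : Channel h k} {d : ℕ} [NeZero d]

lemma minOutputEntropy_randomUnitaryExtension_ge [Nonempty h] [Nonempty k] {ε δ : ℝ}
    (hδ : ∀ A B : Matrix k k ℂ, IsDensity A → B.IsHermitian → ‖B - A‖ < δ →
      entropy A - ε < entropy B)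
    (V : StinespringDilation Φ d) (hd : 2 ≤ d) (hV : ‖V.perpOutput - maxMixed k‖ < δ) :
    minOutputEntropy Φ.toLinearMap + Real.logb 2 V.b - ε ≤
      minOutputEntropy (randomUnitaryExtension V) := by
  have : Nonempty (Fin V.b) := ⟨⟨0, V.b_pos⟩⟩
  refine le_minOutputEntropy fun A hA => ?_
  obtain ⟨B, hB, hAB⟩ := exists_density_smul (hA.1.submatrix (Prod.mk (0 : Fin d)))
  have hp := trace_submatrix_mem_Icc hA
  rw [randomUnitaryExtension_apply, hA.2]
  set X := A.submatrix (Prod.mk (0 : Fin d)) (Prod.mk (0 : Fin d)) with hX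
  set p := X.trace.re with hpdef
  have hXt : X.trace = p := by
    rw [hAB, trace_smul, hB.2, smul_eq_mul, mul_one]
  have hB' := Φ.isDensity_map hB
  have hEq : Φ.toLinearMap X + (1 - X.trace) • V.perpOutput =
      (p : ℂ) • Φ.toLinearMap B + ((1 - p : ℝ) : ℂ) • V.perpOutput := by
    rw [hXt, hAB, map_smul]
    simp
  rw [hEq]
  set Y := (p : ℂ) • Φ.toLinearMap B + ((1 - p : ℝ) : ℂ) • V.perpOutput with hY
  have hYh : Y.IsHermitian := by
    simp [Y, Matrix.IsHermitian, conjTranspose_smul, hB'.1.1.eq, V.isHermitian_perpOutput.eq]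
  have hYt : Y.trace = 1 := by
    rw [hY, trace_add, trace_smul, trace_smul, hB'.2, V.trace_perpOutput hd]
    simp
  -- `Z` is the ideal output, with `ω` replaced by the maximally mixed state. It is within `δ` of
  -- `Y` for every weight `p`, and its entropy is at least that of `Φ(B)`.
  set Z := (p : ℂ) • Φ.toLinearMap B + ((1 - p : ℝ) : ℂ) • maxMixed k with hZ
  have hmm := isDensity_maxMixed k
  have h1p : (0 : ℂ) ≤ ((1 - p : ℝ) : ℂ) := by exact_mod_cast sub_nonneg.2 hp.2
  have hZd : IsDensity Z := by
    refine ⟨(hB'.1.smul (by exact_mod_cast hp.1)).add (hmm.1.smul h1p), ?_⟩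
    rw [hZ, trace_add, trace_smul, trace_smul, hB'.2, hmm.2]
    simp
  have hYZ : ‖Y - Z‖ < δ := by
    have : Y - Z = ((1 - p : ℝ) : ℂ) • (V.perpOutput - maxMixed k) := by
      rw [hY, hZ, add_sub_add_left_eq_sub, smul_sub]
    rw [this, norm_smul, Complex.norm_real, Real.norm_of_nonneg (sub_nonneg.2 hp.2)]
    refine lt_of_le_of_lt ?_ hV
    exact mul_le_of_le_one_left (norm_nonneg _) (by linarith [hp.1])
  have hmb := isDensity_maxMixed (Fin V.b)
  rw [entropy_kronecker hYh hmb.1.1 hYt hmb.2, entropy_maxMixed, Fintype.card_fin]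
  have h1 := hδ Z Y hZd hYh hYZ
  have h2 := entropy_le_entropy_mix_maxMixed hB' hp.1 hp.2
  have h3 := minOutputEntropy_le Φ.map_conjTranspose hB
  linarith

/-! ### Upper bound for the extension tensored with `Ψ` -/

lemma randomUnitaryExtension_ketZero_kronecker (V : StinespringDilation Φ d) (X : Matrix h h ℂ) :
    randomUnitaryExtension V (ketZero d ⊗ₖ X) = Φ.toLinearMap X ⊗ₖ maxMixed (Fin V.b) := by
  have h1 : (ketZero d ⊗ₖ X).submatrix (Prod.mk 0) (Prod.mk 0) = X := by
    ext i j; simp [ketZero]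
  have h2 : (ketZero d ⊗ₖ X).trace = X.trace := by
    rw [trace_kronecker]; simp [ketZero]
  rw [randomUnitaryExtension_apply, h1, h2, sub_self, zero_smul, add_zero]

lemma isDensity_ketZero {d : ℕ} [NeZero d] : IsDensity (ketZero d) := by
  refine ⟨?_, by simp [ketZero]⟩
  rw [← ketZero_mul_ketZero]
  nth_rw 1 [← conjTranspose_ketZero]
  exact posSemidef_conjTranspose_mul_self _

lemma IsDensity.reindex {m n : Type*} [Fintype m] [Fintype n] {A : Matrix m m ℂ}
    (hA : IsDensity A) (e : m ≃ n) : IsDensity (Matrix.reindex e e A) := by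
  refine ⟨hA.1.submatrix _, ?_⟩
  rw [← hA.2]
  exact Equiv.sum_comp e.symm fun i => A i i

end

section

variable {h k h' k' : Type*} [Fintype h] [DecidableEq h] [Fintype k] [DecidableEq k] [Fintype h'] [DecidableEq h'] [Fintype k'] [DecidableEq k'] {Φ : Channel h k}
  {d : ℕ} [NeZero d]

/-- The exchange of the last two factors of a triple product. -/
def prodSwapRight (α β γ : Type*) : (α × β) × γ ≃ (α × γ) × β where
  toFun p := ((p.1.1, p.2), p.1.2)
  invFun p := ((p.1.1, p.2), p.1.2)

/-- On inputs supported in `S₀` the extension only appends `I_B / b`; the reindexings move that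
factor past the output of `Ψ`. -/
lemma tensorMap_randomUnitaryExtension (V : StinespringDilation Φ d) (Ψ : Channel h' k')
    (Z : Matrix (h × h') (h × h') ℂ) :
    tensorMap (randomUnitaryExtension V) Ψ.toLinearMap
        (reindex (Equiv.prodAssoc _ _ _).symm (Equiv.prodAssoc _ _ _).symm (ketZero d ⊗ₖ Z)) =
      reindex (prodSwapRight _ _ _) (prodSwapRight _ _ _)
        (tensorMap Φ.toLinearMap Ψ.toLinearMap Z ⊗ₖ maxMixed (Fin V.b)) := by
  induction Z using kronecker_induction with
  | hadd X Y hX hY =>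
    rw [kronecker_add, map_add (tensorMap Φ.toLinearMap Ψ.toLinearMap), add_kronecker]
    simp only [reindex_apply, submatrix_add, Pi.add_apply, map_add] at hX hY ⊢
    rw [hX, hY]
  | hk X Y =>
    rw [← kronecker_assoc, ← reindex_symm, Equiv.symm_apply_apply, tensorMap_kronecker,
      tensorMap_kronecker, randomUnitaryExtension_ketZero_kronecker]
    ext ⟨⟨a, b⟩, c⟩ ⟨⟨a', b'⟩, c'⟩
    simp [prodSwapRight, mul_right_comm]

lemma minOutputEntropy_tensorMap_randomUnitaryExtension_le [Nonempty h]
    (V : StinespringDilation Φ d) (Ψ : Channel h' k') {A : Matrix (h × h') (h × h') ℂ} (hA : IsDensity A) :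
    minOutputEntropy (tensorMap (randomUnitaryExtension V) Ψ.toLinearMap) ≤
      entropy (tensorMap Φ.toLinearMap Ψ.toLinearMap A) + Real.logb 2 V.b := by
  have : Nonempty (Fin V.b) := ⟨⟨0, V.b_pos⟩⟩
  have h1 := minOutputEntropy_le
    (tensorMap_conjTranspose (randomUnitaryExtension_conjTranspose V) Ψ.map_conjTranspose)
    ((isDensity_ketZero.kronecker hA).reindex (Equiv.prodAssoc (Fin d) h h').symm)
  have hmb := isDensity_maxMixed (Fin V.b)
  have hAh : (tensorMap Φ.toLinearMap Ψ.toLinearMap A).IsHermitian := by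
    rw [Matrix.IsHermitian, ← tensorMap_conjTranspose Φ.map_conjTranspose Ψ.map_conjTranspose,
      hA.1.1.eq]
  have hAt := (trace_tensorMap Φ.trace_preserving Ψ.trace_preserving A).trans hA.2
  have hh : (tensorMap Φ.toLinearMap Ψ.toLinearMap A ⊗ₖ maxMixed (Fin V.b)).IsHermitian := by
    rw [Matrix.IsHermitian, conjTranspose_kronecker, hAh.eq, hmb.1.1.eq]
  rwa [tensorMap_randomUnitaryExtension, entropy_reindex _ hh,
    entropy_kronecker hAh hmb.1.1 hAt hmb.2, entropy_maxMixed, Fintype.card_fin] at h1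

end

end

end QInfo

theorem mainTheorem1 {h k h' k' : Type*}
    [Fintype h] [DecidableEq h] [Nonempty h] [Fintype k] [DecidableEq k] [Nonempty k]
    [Fintype h'] [DecidableEq h'] [Nonempty h'] [Fintype k'] [DecidableEq k'] [Nonempty k']
    (Φ : QInfo.Channel h k) (Ψ : QInfo.Channel h' k')
    (hadd : ∃ d₀ : ℕ, ∀ (d : ℕ) [NeZero d], d₀ ≤ d →
      Nonempty (QInfo.StinespringDilation Φ d) →
      ∃ V : QInfo.StinespringDilation Φ d,
        QInfo.minOutputEntropy
            (QInfo.tensorMap (QInfo.randomUnitaryExtension V) Ψ.toLinearMap) =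
          QInfo.minOutputEntropy (QInfo.randomUnitaryExtension V) +
            QInfo.minOutputEntropy Ψ.toLinearMap) :
    QInfo.minOutputEntropy (QInfo.tensorMap Φ.toLinearMap Ψ.toLinearMap) =
      QInfo.minOutputEntropy Φ.toLinearMap + QInfo.minOutputEntropy Ψ.toLinearMap := by
  refine le_antisymm (QInfo.minOutputEntropy_tensorMap_le Φ Ψ) ?_
  refine QInfo.le_minOutputEntropy fun A hA => le_of_forall_pos_le_add fun ε hε => ?_
  obtain ⟨d₀, hadd⟩ := hadd
  obtain ⟨δ, hδ0, hδ⟩ := QInfo.entropy_near_density (h := k) hε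
  set C : ℝ := ‖(Fintype.card h : ℂ)⁻¹ •
    (((Fintype.card h : ℂ) / Fintype.card k) • (1 : Matrix k k ℂ) - Φ.toLinearMap 1)‖ with hC
  obtain ⟨N, hN⟩ := exists_nat_gt (C / δ)
  -- The bounds on `m` serve, in turn, the additivity hypothesis, the room for Kraus operators with
  -- `b = dim H * m`, and `d - 1 > C / δ` together with `d ≥ 2`.
  let m := max (max d₀ (Fintype.card k)) (N + 2)
  let d := Fintype.card k * m
  have hm0 : 0 < m := lt_of_lt_of_le (by omega) (le_max_right _ _)
  have hmd : m ≤ d := Nat.le_mul_of_pos_left _ Fintype.card_pos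
  have hNd : N + 2 ≤ d := (le_max_right _ _).trans hmd
  have : NeZero d := ⟨by omega⟩
  obtain ⟨V, hV⟩ := hadd d (((le_max_left _ _).trans (le_max_left _ _)).trans hmd)
    (Φ.nonempty_stinespringDilation (b := Fintype.card h * m) (by simp only [d]; ring)
      (Nat.mul_le_mul_left _ ((le_max_right _ _).trans (le_max_left _ _))))
  have hd1 : (N : ℝ) + 1 ≤ (d : ℝ) - 1 := by
    have : ((N + 2 : ℕ) : ℝ) ≤ d := by exact_mod_cast hNd
    push_cast at this
    linarith
  have hdpos : (0 : ℝ) < (d : ℝ) - 1 := lt_of_lt_of_le (by positivity) hd1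
  have hclose : ‖V.perpOutput - QInfo.maxMixed k‖ < δ := by
    rw [V.perpOutput_sub_maxMixed (by omega), norm_smul, ← hC, norm_inv,
      show ((d : ℂ) - 1) = (((d : ℝ) - 1 : ℝ) : ℂ) by push_cast; rfl, Complex.norm_real,
      Real.norm_of_nonneg hdpos.le, inv_mul_lt_iff₀ hdpos]
    rw [div_lt_iff₀ hδ0] at hN
    nlinarith
  -- The same `V.b` occurs in both bounds, so its logarithm cancels.
  have h1 := QInfo.minOutputEntropy_randomUnitaryExtension_ge hδ V (by omega) hclose
  have h2 := QInfo.minOutputEntropy_tensorMap_randomUnitaryExtension_le V Ψ hA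
  linarith
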